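/- A (closed) bottomless rectangle with left-coordinate $l$, right-coordinate $r$ (where $l<r$) and height $t$ is the set $\{(x,y)\in\mathbb R^2 : l\le x\le r,\ y\le t\}$. Bottomless rectangles are presented one at a time from one of four directions: from below (in strictly increasing order of height), from above (in strictly decreasing order of height), from the left (in strictly increasing order of left-coordinate), or from the right (in strictly decreasing order of right-coordinate). A semi-online algorithm that $k$-colours bottomless rectangles from a given direction maintains, after each presented rectangle and depending only on the rectangles presented so far, a partial colouring of these rectangles with $k$ colours. It may leave rectangles uncoloured and colour them at a later step, but once a rectangle has received a colour, this colour is never changed or removed. Theorem. Let $k$ and $m$ be non-negative integers and let a direction (from below, from above, from the left, or from the right) be given. For every semi-online algorithm that $k$-colours bottomless rectangles from this direction, there is a finite family of bottomless rectangles such that, after the family has been presented to the algorithm from this direction, some point of the plane is covered by exactly $m$ rectangles of the family, and at most one colour occurs among those of these $m$ rectangles that have been coloured. -/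

import Mathlib

/-- A (closed, non-degenerate) bottomless rectangle, given by its left-coordinate `l`,
its right-coordinate `r` and its height `t`. -/
@[ext]
structure BottomlessRectangle where
  l : ℝ
  r : ℝ
  t : ℝ
  l_lt_r : l < r

/-- The region of the plane occupied by a bottomless rectangle. -/
def BottomlessRectangle.region (R : BottomlessRectangle) : Set (ℝ × ℝ) :=
  {p | R.l ≤ p.1 ∧ p.1 ≤ R.r ∧ p.2 ≤ R.t}

/-- The four directions from which bottomless rectangles can be presented. -/
inductive Direction where
  | fromBelow
  | fromAbove
  | fromLeft
  | fromRight

/-- `d.Before R S`: the rectangle `R` comes before `S` when rectangles arrive from direction `d`.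
From below (above): increasing (decreasing) height; from the left: increasing left-coordinate;
from the right: decreasing right-coordinate. -/
def Direction.Before : Direction → BottomlessRectangle → BottomlessRectangle → Prop
  | .fromBelow, R, S => R.t < S.t
  | .fromAbove, R, S => S.t < R.t
  | .fromLeft, R, S => R.l < S.l
  | .fromRight, R, S => S.r < R.r

/-- A finite family of bottomless rectangles, listed in the order in which its members are
presented from direction `d`. In particular, its members are pairwise distinct. -/
def IsPresentation (d : Direction) (F : List BottomlessRectangle) : Prop :=
  F.Pairwise d.Before

/-- A semi-online algorithm that `k`-colours bottomless rectangles from direction `d`.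
After the rectangles of `F` have been presented in this order, and with no knowledge of later
rectangles, it has the partial colouring `colour F` of the members of `F` (`none` means that the
rectangle has not been coloured yet). Values of `colour F` outside of `F` have no meaning.
Colours are never changed or removed, but a rectangle may be coloured at any step
from its arrival on. -/
structure SemiOnlineAlgorithm (d : Direction) (k : ℕ) where
  colour : List BottomlessRectangle → BottomlessRectangle → Option (Fin k)
  irrevocable : ∀ (F : List BottomlessRectangle) (S : BottomlessRectangle),
    IsPresentation d (F ++ [S]) →
      ∀ R ∈ F, ∀ c : Fin k, colour F R = some c → colour (F ++ [S]) R = some c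

/-- The members of the family `F` that cover the point `p`. -/
def coveringRectangles (F : List BottomlessRectangle) (p : ℝ × ℝ) : Set BottomlessRectangle :=
  {R | R ∈ F ∧ p ∈ R.region}

/-- The colours that cover the point `p` once the algorithm has received the family `F`. -/
def SemiOnlineAlgorithm.coveringColours {d : Direction} {k : ℕ} (A : SemiOnlineAlgorithm d k)
    (F : List BottomlessRectangle) (p : ℝ × ℝ) : Set (Fin k) :=
  {c | ∃ R ∈ coveringRectangles F p, A.colour F R = some c}

/-!
From each of the four directions one can simulate the same game on the line: closed subintervals
of `(0, 1)` are presented in an *arbitrary* order, and one looks for a point `x` contained in exactly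
`m` of them, at most one colour occurring among these. From below and from above, use the rectangles
over the intervals, with the height as time stamp, and the points `(x, 0)`. From the left, let the
left-coordinate be a negative time stamp and represent `[a, b]` by the corner `(b, -a)`: of the
points `(x, -x)` of the antidiagonal with `0 < x`, the rectangle covers those with `a ≤ x ≤ b`.
The right is symmetric. This is `IntervalRealization`.

The game is won inside every open interval, whatever has been played before, by induction on `m`
(`exists_unicoloured_stack`). To gain one level, one aims at a point all of whose intervals are
*already coloured* with the same colour `c`, and which lies in exactly `a c` of them; if
`a c = m` for all `c`, this wins. The proof is by induction on `∑ c, a c`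
(`exists_unicoloured_or_monochromatic_stack`). For every colour `c`, prepare in a separate place a
point `x c` that lies in exactly `a c - 1` intervals, all coloured `c`. Then present an interval `I`
that contains all the points `x c` and a region `K` that has not been used so far, and win the
game for `m - 1` inside `K`. If `I` is still uncoloured, then adding it to the intervals found in `K`
wins the game for `m`. If `I` has received the colour `c`, then `x c` lies in exactly `a c`
intervals, all coloured `c`; it does not matter when `I` received its colour, since the
intervals at `x c` cannot change any more.
-/

open Set

/-- A way of presenting closed subintervals of `(0, 1)` in arbitrary order as bottomless rectangles
from direction `d`: the number `x` is represented by the point `point x`, and a legal list of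
rectangles can be continued by one that represents a given interval. -/
structure IntervalRealization (d : Direction) where
  /-- The point of the plane that represents a number of `(0, 1)`. -/
  point : ℝ → ℝ × ℝ
  /-- The presentations that can be continued by every interval. -/
  Legal : List BottomlessRectangle → Prop
  legal_nil : Legal []
  isPresentation : ∀ {F}, Legal F → IsPresentation d F
  extend : ∀ {F a b}, Legal F → 0 < a → a < b → b < 1 →
    ∃ R, Legal (F ++ [R]) ∧ ∀ x ∈ Ioo (0 : ℝ) 1, point x ∈ R.region ↔ x ∈ Icc a b

/-! ### Time stamps -/

theorem exists_between_list {α : Type*} (f : α → ℝ) {lo hi : ℝ} (h : lo < hi) (F : List α)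
    (hF : ∀ R ∈ F, f R < hi) : ∃ s, lo < s ∧ s < hi ∧ ∀ R ∈ F, f R < s := by
  induction F with
  | nil =>
    obtain ⟨s, h1, h2⟩ := exists_between h
    exact ⟨s, h1, h2, by simp⟩
  | cons R F ih =>
    obtain ⟨s, h1, h2, h3⟩ := ih fun S hS => hF S (List.mem_cons_of_mem _ hS)
    obtain ⟨s', h4, h5⟩ := exists_between (max_lt h2 (hF R List.mem_cons_self))
    obtain ⟨h6, h7⟩ := max_lt_iff.1 h4
    refine ⟨s', h1.trans h6, h5, fun S hS => ?_⟩
    rcases List.mem_cons.1 hS with rfl | hS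
    · exact h7
    · exact (h3 S hS).trans h6

theorem IsPresentation.concat {d : Direction} {F : List BottomlessRectangle}
    {R : BottomlessRectangle} (hF : IsPresentation d F) (hR : ∀ S ∈ F, d.Before S R) :
    IsPresentation d (F ++ [R]) := by
  refine List.pairwise_append.2 ⟨hF, List.pairwise_singleton _ _, fun S hS T hT => ?_⟩
  rw [List.mem_singleton.1 hT]
  exact hR S hS

theorem List.forall_mem_concat {α : Type*} {p : α → Prop} {F : List α} {R : α}
    (hF : ∀ S ∈ F, p S) (hR : p R) : ∀ S ∈ F ++ [R], p S := by
  intro S hS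
  rcases List.mem_append.1 hS with hS | hS
  · exact hF S hS
  · rwa [List.mem_singleton.1 hS]

/-! ### The four directions -/

/-- Intervals are presented from below by rectangles with increasing heights in `(0, 1)`. -/
def IntervalRealization.fromBelow : IntervalRealization .fromBelow where
  point x := (x, 0)
  Legal F := IsPresentation .fromBelow F ∧ ∀ R ∈ F, 0 < R.t ∧ R.t < 1
  legal_nil := ⟨List.Pairwise.nil, by simp⟩
  isPresentation h := h.1
  extend {F a b} h ha hab hb := by
    obtain ⟨s, h0, h1, hs⟩ := exists_between_list (fun R : BottomlessRectangle => R.t)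
      (zero_lt_one (α := ℝ)) F fun R hR => (h.2 R hR).2
    refine ⟨⟨a, b, s, hab⟩, ⟨h.1.concat hs, List.forall_mem_concat h.2 ⟨h0, h1⟩⟩, fun x hx => ?_⟩
    exact ⟨fun h => ⟨h.1, h.2.1⟩, fun h => ⟨h.1, h.2, h0.le⟩⟩

/-- Intervals are presented from above by rectangles with decreasing positive heights. -/
def IntervalRealization.fromAbove : IntervalRealization .fromAbove where
  point x := (x, 0)
  Legal F := IsPresentation .fromAbove F ∧ ∀ R ∈ F, 0 < R.t
  legal_nil := ⟨List.Pairwise.nil, by simp⟩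
  isPresentation h := h.1
  extend {F a b} h ha hab hb := by
    obtain ⟨s, -, h0, hs⟩ := exists_between_list (fun R : BottomlessRectangle => -R.t)
      (neg_one_lt_zero (R := ℝ)) F fun R hR => neg_lt_zero.2 (h.2 R hR)
    refine ⟨⟨a, b, -s, hab⟩, ⟨h.1.concat fun S hS => neg_lt.1 (hs S hS),
      List.forall_mem_concat h.2 (neg_pos.2 h0)⟩, fun x hx => ?_⟩
    exact ⟨fun h => ⟨h.1, h.2.1⟩, fun h => ⟨h.1, h.2, (neg_pos.2 h0).le⟩⟩

/-- From the left, `x` is represented on the antidiagonal, and `[a, b]` by a rectangle with upper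
right corner `(b, -a)` and negative left-coordinate. -/
def IntervalRealization.fromLeft : IntervalRealization .fromLeft where
  point x := (x, -x)
  Legal F := IsPresentation .fromLeft F ∧ ∀ R ∈ F, R.l < 0
  legal_nil := ⟨List.Pairwise.nil, by simp⟩
  isPresentation h := h.1
  extend {F a b} h ha hab hb := by
    obtain ⟨s, -, h0, hs⟩ := exists_between_list (fun R : BottomlessRectangle => R.l)
      (neg_one_lt_zero (R := ℝ)) F h.2
    refine ⟨⟨s, b, -a, h0.trans (ha.trans hab)⟩, ⟨h.1.concat hs,
      List.forall_mem_concat h.2 h0⟩, fun x hx => ?_⟩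
    exact ⟨fun h => ⟨neg_le_neg_iff.1 h.2.2, h.2.1⟩,
      fun h => ⟨(h0.trans hx.1).le, h.2, neg_le_neg h.1⟩⟩

/-- From the right, `x` is represented on the diagonal, and `[a, b]` by a rectangle with upper
left corner `(a, b)` and right-coordinate greater than `1`. -/
def IntervalRealization.fromRight : IntervalRealization .fromRight where
  point x := (x, x)
  Legal F := IsPresentation .fromRight F ∧ ∀ R ∈ F, 1 < R.r
  legal_nil := ⟨List.Pairwise.nil, by simp⟩
  isPresentation h := h.1
  extend {F a b} h ha hab hb := by
    obtain ⟨s, -, h0, hs⟩ := exists_between_list (fun R : BottomlessRectangle => -R.r)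
      (sub_one_lt (-1 : ℝ)) F fun R hR => neg_lt_neg (h.2 R hR)
    have h1 : 1 < -s := lt_neg.1 h0
    refine ⟨⟨a, -s, b, (hab.trans hb).trans h1⟩, ⟨h.1.concat fun S hS => neg_lt.1 (hs S hS),
      List.forall_mem_concat h.2 h1⟩, fun x hx => ?_⟩
    exact ⟨fun h => ⟨h.1, h.2.2⟩, fun h => ⟨h.1, (hx.2.trans h1).le, h.2⟩⟩

theorem nonempty_intervalRealization (d : Direction) : Nonempty (IntervalRealization d) := by
  cases d
  · exact ⟨.fromBelow⟩
  · exact ⟨.fromAbove⟩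
  · exact ⟨.fromLeft⟩
  · exact ⟨.fromRight⟩

/-! ### Stacks and plays -/

namespace IntervalRealization

variable {d : Direction} (ρ : IntervalRealization d)

open Classical in
/-- The members of the list `G` whose intervals contain `x`. -/
noncomputable def stack (G : List BottomlessRectangle) (x : ℝ) : List BottomlessRectangle :=
  G.filter fun R => ρ.point x ∈ R.region

theorem mem_stack {G : List BottomlessRectangle} {x : ℝ} {R : BottomlessRectangle} :
    R ∈ ρ.stack G x ↔ R ∈ G ∧ ρ.point x ∈ R.region := by
  simp [stack]

theorem stack_append (G H : List BottomlessRectangle) (x : ℝ) :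
    ρ.stack (G ++ H) x = ρ.stack G x ++ ρ.stack H x := by
  simp [stack]

theorem stack_singleton {R : BottomlessRectangle} {x : ℝ} (h : ρ.point x ∈ R.region) :
    ρ.stack [R] x = [R] := by
  simp [stack, h]

/-- After the list `F`, the list `G` can be presented, and all its intervals lie in `(u, v)`. -/
def IsPlay (F : List BottomlessRectangle) (u v : ℝ) (G : List BottomlessRectangle) : Prop :=
  ρ.Legal (F ++ G) ∧ ∀ R ∈ G, ∀ x ∈ Ioo (0 : ℝ) 1, ρ.point x ∈ R.region → x ∈ Ioo u v

variable {ρ}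

theorem isPlay_nil {F : List BottomlessRectangle} (hF : ρ.Legal F) (u v : ℝ) :
    ρ.IsPlay F u v [] :=
  ⟨by simpa using hF, by simp⟩

theorem IsPlay.mono {F G : List BottomlessRectangle} {u v u' v' : ℝ} (h : ρ.IsPlay F u v G)
    (hu : u' ≤ u) (hv : v ≤ v') : ρ.IsPlay F u' v' G :=
  ⟨h.1, fun R hR x hx hxR => Ioo_subset_Ioo hu hv (h.2 R hR x hx hxR)⟩

theorem IsPlay.append {F G H : List BottomlessRectangle} {u v : ℝ} (hG : ρ.IsPlay F u v G)
    (hH : ρ.IsPlay (F ++ G) u v H) : ρ.IsPlay F u v (G ++ H) := by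
  refine ⟨by simpa using hH.1, fun R hR => ?_⟩
  rcases List.mem_append.1 hR with hR | hR
  · exact hG.2 R hR
  · exact hH.2 R hR

theorem IsPlay.stack_eq_nil {F G : List BottomlessRectangle} {u v x : ℝ} (h : ρ.IsPlay F u v G)
    (hx : x ∈ Ioo (0 : ℝ) 1) (hxuv : x ∉ Ioo u v) : ρ.stack G x = [] :=
  List.eq_nil_iff_forall_not_mem.2 fun R hR =>
    hxuv (h.2 R (ρ.mem_stack.1 hR).1 x hx (ρ.mem_stack.1 hR).2)

end IntervalRealization

/-! ### Colours -/

theorem SemiOnlineAlgorithm.colour_append {d : Direction} {k : ℕ} (A : SemiOnlineAlgorithm d k)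
    {F G : List BottomlessRectangle} (h : IsPresentation d (F ++ G)) {R : BottomlessRectangle}
    (hR : R ∈ F) {c : Fin k} (hc : A.colour F R = some c) : A.colour (F ++ G) R = some c := by
  induction G using List.reverseRecOn with
  | nil => simpa using hc
  | append_singleton G S ih =>
    rw [← List.append_assoc] at h ⊢
    exact A.irrevocable _ _ h R (List.mem_append_left _ hR) c (ih (List.pairwise_append.1 h).1)

namespace IntervalRealization

variable {d : Direction} (ρ : IntervalRealization d) {k : ℕ} (A : SemiOnlineAlgorithm d k)

/-- After `F` and then `G` have been presented, `x` lies in exactly `m` intervals of `G`, and at most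
one colour occurs among them. -/
def Unicoloured (F G : List BottomlessRectangle) (x : ℝ) (m : ℕ) : Prop :=
  (ρ.stack G x).length = m ∧ ∀ R ∈ ρ.stack G x, ∀ S ∈ ρ.stack G x, ∀ c c',
    A.colour (F ++ G) R = some c → A.colour (F ++ G) S = some c' → c = c'

/-- After `F` and then `G` have been presented, `x` lies in exactly `m` intervals of `G`, and all
of them have received the colour `c`. -/
def Monochromatic (F G : List BottomlessRectangle) (x : ℝ) (c : Fin k) (m : ℕ) : Prop :=
  (ρ.stack G x).length = m ∧ ∀ R ∈ ρ.stack G x, A.colour (F ++ G) R = some c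

variable {ρ A}

theorem Monochromatic.unicoloured {F G : List BottomlessRectangle} {x : ℝ} {c : Fin k} {m : ℕ}
    (h : ρ.Monochromatic A F G x c m) : ρ.Unicoloured A F G x m :=
  ⟨h.1, fun R hR S hS e e' he he' => by
    rw [h.2 R hR] at he
    rw [h.2 S hS] at he'
    exact Option.some.inj (he.symm.trans he')⟩

/-- Colours are never removed, so a monochromatic stack persists as long as nothing is
added to it. -/
theorem Monochromatic.append {F G H : List BottomlessRectangle} {x : ℝ} {c : Fin k} {m : ℕ}
    (h : ρ.Monochromatic A F G x c m) (hl : ρ.Legal (F ++ G ++ H)) (hH : ρ.stack H x = []) :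
    ρ.Monochromatic A F (G ++ H) x c m := by
  have hs : ρ.stack (G ++ H) x = ρ.stack G x := by rw [stack_append, hH, List.append_nil]
  refine ⟨hs ▸ h.1, fun R hR => ?_⟩
  rw [hs] at hR
  rw [← List.append_assoc]
  exact A.colour_append (ρ.isPresentation hl)
    (List.mem_append_right _ (ρ.mem_stack.1 hR).1) (h.2 R hR)

/-- Intervals that avoid `x` do not matter for the colours at `x`. -/
theorem Monochromatic.prepend {F G H : List BottomlessRectangle} {x : ℝ} {c : Fin k} {m : ℕ}
    (h : ρ.Monochromatic A (F ++ G) H x c m) (hG : ρ.stack G x = []) :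
    ρ.Monochromatic A F (G ++ H) x c m := by
  have hs : ρ.stack (G ++ H) x = ρ.stack H x := by rw [stack_append, hG, List.nil_append]
  unfold Monochromatic
  rw [hs, ← List.append_assoc]
  exact h

theorem Unicoloured.prepend {F G H : List BottomlessRectangle} {x : ℝ} {m : ℕ}
    (h : ρ.Unicoloured A (F ++ G) H x m) (hG : ρ.stack G x = []) :
    ρ.Unicoloured A F (G ++ H) x m := by
  have hs : ρ.stack (G ++ H) x = ρ.stack H x := by rw [stack_append, hG, List.nil_append]
  unfold Unicoloured
  rw [hs, ← List.append_assoc]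
  exact h

/-! ### The strategy -/

variable (ρ A)

/-- Inside every interval one can either force a point that lies in exactly `m` new intervals with
at most one colour, or a point that, for some colour `c`, lies in exactly `a c` new intervals, all of
them coloured `c`. -/
def Forces (m : ℕ) (a : Fin k → ℕ) : Prop :=
  ∀ F u v, ρ.Legal F → 0 ≤ u → u < v → v ≤ 1 →
    ∃ G x, ρ.IsPlay F u v G ∧ x ∈ Ioo u v ∧
      (ρ.Unicoloured A F G x m ∨ ∃ c, ρ.Monochromatic A F G x c (a c))

variable {ρ A}

/-- Playing side by side, one can prepare for every colour `c` of `s` a point that is one step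
short of its target `a c`, unless one of the goals is reached on the way. -/
theorem exists_prepared_points {m : ℕ} {a : Fin k → ℕ}
    (ih : ∀ c, ρ.Forces A m (Function.update a c (a c - 1))) (s : Finset (Fin k))
    {F : List BottomlessRectangle} {u v : ℝ} (hF : ρ.Legal F) (hu : 0 ≤ u) (huv : u < v)
    (hv : v ≤ 1) :
    ∃ G, ρ.IsPlay F u v G ∧
      ((∃ x ∈ Ioo u v, ρ.Unicoloured A F G x m ∨ ∃ c, ρ.Monochromatic A F G x c (a c)) ∨
        ∀ c ∈ s, ∃ x ∈ Ioo u v, ρ.Monochromatic A F G x c (a c - 1)) := by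
  induction s using Finset.induction_on generalizing v with
  | empty => exact ⟨[], isPlay_nil hF u v, Or.inr (by simp)⟩
  | insert e s _ ihs =>
    obtain ⟨w, huw, hwv⟩ := exists_between huv
    obtain ⟨G, hG, hG'⟩ := ihs huw (hwv.le.trans hv)
    rcases hG' with ⟨x, hx, h⟩ | hpts
    · exact ⟨G, hG.mono le_rfl hwv.le, Or.inl ⟨x, Ioo_subset_Ioo_right hwv.le hx, h⟩⟩
    obtain ⟨H, x, hH, hx, h⟩ := ih e (F ++ G) w v hG.1 (hu.trans huw.le) hwv hv
    have hxG : ρ.stack G x = [] := hG.stack_eq_nil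
      ⟨(hu.trans_lt huw).trans hx.1, hx.2.trans_le hv⟩ fun h => (h.2.trans hx.1).false
    have hx' : x ∈ Ioo u v := Ioo_subset_Ioo_left huw.le hx
    refine ⟨G ++ H, (hG.mono le_rfl hwv.le).append (hH.mono huw.le le_rfl), ?_⟩
    rcases h with h | ⟨c, h⟩
    · exact Or.inl ⟨x, hx', Or.inl (h.prepend hxG)⟩
    by_cases hce : c = e
    · subst hce
      rw [Function.update_self] at h
      refine Or.inr fun c' hc' => ?_
      rcases Finset.mem_insert.1 hc' with rfl | hc'
      · exact ⟨x, hx', h.prepend hxG⟩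
      · obtain ⟨y, hy, hy'⟩ := hpts c' hc'
        exact ⟨y, Ioo_subset_Ioo_right hwv.le hy, hy'.append hH.1 (hH.stack_eq_nil
          ⟨hu.trans_lt hy.1, (hy.2.trans hwv).trans_le hv⟩ fun h => (h.1.trans hy.2).false)⟩
    · rw [Function.update_of_ne hce] at h
      exact Or.inl ⟨x, hx', Or.inr ⟨c, h.prepend hxG⟩⟩

/-- The interval `I` is presented over the prepared points and over an unused region, in which a
winning play for `m` follows. Whether or not `I` gets coloured, progress is made. -/
theorem exists_unicoloured_or_monochromatic_stack {m : ℕ}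
    (win : ∀ F u v, ρ.Legal F → 0 ≤ u → u < v → v ≤ 1 →
      ∃ G x, ρ.IsPlay F u v G ∧ x ∈ Ioo u v ∧ ρ.Unicoloured A F G x m)
    (a : Fin k → ℕ) : ρ.Forces A (m + 1) a := by
  induction hn : ∑ c, a c using Nat.strong_induction_on generalizing a with
  | _ n ih =>
  subst hn
  intro F u v hF hu huv hv
  by_cases h0 : ∃ c, a c = 0
  · obtain ⟨c, hc⟩ := h0
    obtain ⟨x, hx⟩ := exists_between huv
    exact ⟨[], x, isPlay_nil hF u v, hx, Or.inr ⟨c, by simp [stack, hc], by simp [stack]⟩⟩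
  push Not at h0
  -- The points are prepared in `(u', w)`, the interval `I` is `[u', v']`, and `(w, v')` is unused.
  obtain ⟨w, huw, hwv⟩ := exists_between huv
  obtain ⟨u', hu', hu'w⟩ := exists_between huw
  obtain ⟨v', hwv', hv'⟩ := exists_between hwv
  have hu'0 : 0 < u' := hu.trans_lt hu'
  have hv'1 : v' < 1 := hv'.trans_le hv
  obtain ⟨G, hG, hG'⟩ := exists_prepared_points (a := a) (m := m + 1) (ρ := ρ) (A := A)
    (fun c => ih _ (Finset.sum_lt_sum (fun e _ => by
        rcases eq_or_ne e c with rfl | he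
        · simp
        · simp [he]) ⟨c, Finset.mem_univ c, by simpa using Nat.pos_of_ne_zero (h0 c)⟩) _ rfl)
    Finset.univ hF hu'0.le hu'w (hwv'.trans hv'1).le
  have hGuv : ρ.IsPlay F u v G := hG.mono hu'.le hwv.le
  rcases hG' with ⟨x, hx, h⟩ | hpts
  · exact ⟨G, x, hGuv, Ioo_subset_Ioo hu'.le hwv.le hx, h⟩
  obtain ⟨I, hI, hIx⟩ := ρ.extend hG.1 hu'0 (hu'w.trans hwv') hv'1
  obtain ⟨H, x, hH, hx, hcard, hcol⟩ :=
    win (F ++ G ++ [I]) w v' hI (hu'0.trans hu'w).le hwv' hv'1.le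
  have hIplay : ρ.IsPlay (F ++ G) u v [I] := ⟨hI, fun R hR y hy hyR => by
    rw [List.mem_singleton.1 hR, hIx y hy] at hyR
    exact ⟨hu'.trans_le hyR.1, hyR.2.trans_lt hv'⟩⟩
  have hplay : ρ.IsPlay F u v (G ++ ([I] ++ H)) := hGuv.append <| hIplay.append <|
    hH.mono huw.le hv'.le
  cases hc : A.colour (F ++ (G ++ ([I] ++ H))) I with
  | none =>
    have hx01 : x ∈ Ioo (0 : ℝ) 1 := ⟨(hu'0.trans hu'w).trans hx.1, hx.2.trans hv'1⟩
    have hstack : ρ.stack (G ++ ([I] ++ H)) x = [I] ++ ρ.stack H x := by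
      rw [stack_append, stack_append, hG.stack_eq_nil hx01 fun h => (h.2.trans hx.1).false,
        ρ.stack_singleton ((hIx x hx01).2 ⟨(hu'w.trans hx.1).le, hx.2.le⟩), List.nil_append]
    refine ⟨_, x, hplay, ⟨huw.trans hx.1, hx.2.trans hv'⟩, Or.inl ⟨?_, ?_⟩⟩
    · rw [hstack, List.length_append, hcard, List.length_singleton, add_comm]
    · intro R hR S hS c c' hRc hSc
      have key : ∀ T ∈ ρ.stack (G ++ ([I] ++ H)) x, ∀ e,
          A.colour (F ++ (G ++ ([I] ++ H))) T = some e → T ∈ ρ.stack H x := by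
        intro T hT e he
        rw [hstack] at hT
        rcases List.mem_append.1 hT with hT | hT
        · rw [List.mem_singleton.1 hT, hc] at he
          cases he
        · exact hT
      refine hcol R (key R hR c hRc) S (key S hS c' hSc) c c' ?_ ?_ <;> simpa
  | some c =>
    obtain ⟨y, hy, hmono⟩ := hpts c (Finset.mem_univ c)
    have hy01 : y ∈ Ioo (0 : ℝ) 1 := ⟨hu'0.trans hy.1, (hy.2.trans hwv').trans hv'1⟩
    have hstack : ρ.stack (G ++ ([I] ++ H)) y = ρ.stack G y ++ [I] := by
      rw [stack_append, stack_append, hH.stack_eq_nil hy01 fun h => (h.1.trans hy.2).false,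
        ρ.stack_singleton ((hIx y hy01).2 ⟨hy.1.le, (hy.2.trans hwv').le⟩), List.append_nil]
    refine ⟨_, y, hplay, Ioo_subset_Ioo hu'.le hwv.le hy, Or.inr ⟨c, ?_, fun R hR => ?_⟩⟩
    · rw [hstack, List.length_append, hmono.1, List.length_singleton]
      exact Nat.sub_add_cancel (Nat.pos_of_ne_zero (h0 c))
    · rw [hstack] at hR
      rcases List.mem_append.1 hR with hR | hR
      · rw [← List.append_assoc]
        exact A.colour_append (by simpa using ρ.isPresentation hplay.1)
          (List.mem_append_right _ (ρ.mem_stack.1 hR).1) (hmono.2 R hR)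
      · rw [List.mem_singleton.1 hR, hc]

theorem exists_unicoloured_stack (ρ : IntervalRealization d) (A : SemiOnlineAlgorithm d k) (m : ℕ) :
    ∀ F u v, ρ.Legal F → 0 ≤ u → u < v → v ≤ 1 →
      ∃ G x, ρ.IsPlay F u v G ∧ x ∈ Ioo u v ∧ ρ.Unicoloured A F G x m := by
  induction m with
  | zero =>
    intro F u v hF _ huv _
    obtain ⟨x, hx⟩ := exists_between huv
    exact ⟨[], x, isPlay_nil hF u v, hx, by simp [stack], by simp [stack]⟩
  | succ m ih =>
    intro F u v hF hu huv hv
    obtain ⟨G, x, hG, hx, h⟩ :=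
      exists_unicoloured_or_monochromatic_stack ih (fun _ => m + 1) F u v hF hu huv hv
    exact ⟨G, x, hG, hx, h.elim id fun ⟨_, hc⟩ => hc.unicoloured⟩

end IntervalRealization

/-! ### From intervals to rectangles -/

theorem IsPresentation.nodup {d : Direction} {F : List BottomlessRectangle}
    (h : IsPresentation d F) : F.Nodup :=
  List.Pairwise.imp (fun {R S} (hRS : d.Before R S) => by
    rintro rfl
    cases d <;> exact lt_irrefl _ hRS) h

theorem mainTheorem2 (k m : ℕ) (d : Direction) (A : SemiOnlineAlgorithm d k) :
    ∃ F : List BottomlessRectangle, IsPresentation d F ∧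
      ∃ p : ℝ × ℝ, (coveringRectangles F p).ncard = m ∧ (A.coveringColours F p).ncard ≤ 1 := by
  classical
  obtain ⟨ρ⟩ := nonempty_intervalRealization d
  obtain ⟨F, x, hF, -, hcard, hcol⟩ :=
    ρ.exists_unicoloured_stack A m [] 0 1 ρ.legal_nil le_rfl one_pos le_rfl
  rw [List.nil_append] at hcol
  have hpres : IsPresentation d F := ρ.isPresentation hF.1
  refine ⟨F, hpres, ρ.point x, ?_, ?_⟩
  · have hset : coveringRectangles F (ρ.point x) = ↑(ρ.stack F x).toFinset := by
      ext R
      simp [coveringRectangles, ρ.mem_stack]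
    have hnodup : (ρ.stack F x).Nodup := hpres.nodup.filter _
    rw [hset, Set.ncard_coe_finset, List.toFinset_card_of_nodup hnodup, hcard]
  · rw [Set.ncard_le_one]
    rintro c ⟨R, hR, hc⟩ c' ⟨S, hS, hc'⟩
    exact hcol R (ρ.mem_stack.2 hR) S (ρ.mem_stack.2 hS) c c' hc hc'
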